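/- Let $F=F(X)$ be the free group on a set $X$. An element of $F$ is \emph{primitive} if it is the image of a letter $x\in X$ under an automorphism of $F$. A \emph{free splitting} $A*B$ of $F$ is a pair $(A,B)$ of subgroups which together generate $F$ and are such that whenever a product $a_1b_1\cdots a_nb_n$ with $n\ge 1$, $a_i\in A$, $b_i\in B$ equals $1$, there is an $i$ with $a_i=1$ or $b_i=1$; it is \emph{proper} if $A\neq F$ and $B\neq F$. Two proper free splittings $A*B$ and $C*D$ are equivalent if there is $x\in F$ with $A=xCx^{-1}$ and $B=xDx^{-1}$, or $A=xDx^{-1}$ and $B=xCx^{-1}$; the class of $A*B$ is denoted $[A*B]$. An element $g\in F$ is \emph{elliptic} to $[A*B]$ if $g\in xAx^{-1}$ or $g\in xBx^{-1}$ for some $x\in F$ (this does not depend on the representative of the class). (1) If $A*B$ and $C*D$ are free splittings of $F$ with $A\cap C\neq 1$, then $A\cap C$ contains a primitive element of $F$. (2) Let $[A*B]$ and $[C*D]$ be classes of proper free splittings of $F$. If some nontrivial element $f\in F$ is elliptic to both classes, then some primitive element $g\in F$ is elliptic to both classes. -/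

import Mathlib

open scoped Pointwise

namespace EllipticityGraph

/-- The pair `(A, B)` of subgroups of `G` is a free splitting `A * B` of `G`: whenever a product
`a₀ b₀ a₁ b₁ ⋯ aₙ bₙ` (with at least one pair of factors, `aᵢ ∈ A` and `bᵢ ∈ B`) is the identity,
some `aᵢ` or some `bᵢ` is the identity; and `A` and `B` together generate `G`. -/
structure IsFreeSplitting {G : Type*} [Group G] (A B : Subgroup G) : Prop where
  eq_one_of_prod_eq_one : ∀ (n : ℕ) (a b : Fin (n + 1) → G),
    (∀ i, a i ∈ A) → (∀ i, b i ∈ B) → (List.ofFn fun i => a i * b i).prod = 1 →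
      ∃ i, a i = 1 ∨ b i = 1
  sup_eq_top : A ⊔ B = ⊤

/-- The element `g` is elliptic to `A * B`: it lies in a conjugate `x A x⁻¹` or `x B x⁻¹`. -/
def IsElliptic {G : Type*} [Group G] (g : G) (A B : Subgroup G) : Prop :=
  ∃ x : G, g ∈ MulAut.conj x • A ∨ g ∈ MulAut.conj x • B

/-- A proper free splitting of `G`: a free splitting whose two factors are proper subgroups. -/
structure ProperFreeSplitting (G : Type*) [Group G] where
  left : Subgroup G
  right : Subgroup G
  isFreeSplitting : IsFreeSplitting left right
  left_ne_top : left ≠ ⊤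
  right_ne_top : right ≠ ⊤

/-- `A * B` and `C * D` are equivalent if some `x` satisfies `A = x C x⁻¹` and `B = x D x⁻¹`,
or `A = x D x⁻¹` and `B = x C x⁻¹`. -/
def ProperFreeSplitting.Equivalent {G : Type*} [Group G] (S T : ProperFreeSplitting G) : Prop :=
  ∃ x : G,
    (S.left = MulAut.conj x • T.left ∧ S.right = MulAut.conj x • T.right) ∨
    (S.left = MulAut.conj x • T.right ∧ S.right = MulAut.conj x • T.left)

theorem ProperFreeSplitting.equivalent_equivalence (G : Type*) [Group G] :
    Equivalence (ProperFreeSplitting.Equivalent (G := G)) where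
  refl S := ⟨1, Or.inl (by simp)⟩
  symm := by
    rintro S T ⟨x, ⟨h₁, h₂⟩ | ⟨h₁, h₂⟩⟩
    · exact ⟨x⁻¹, Or.inl (by simp [h₁, h₂])⟩
    · exact ⟨x⁻¹, Or.inr (by simp [h₁, h₂])⟩
  trans := by
    rintro S T U ⟨x, ⟨h₁, h₂⟩ | ⟨h₁, h₂⟩⟩ ⟨y, ⟨h₃, h₄⟩ | ⟨h₃, h₄⟩⟩
    · exact ⟨x * y, Or.inl (by simp [h₁, h₂, h₃, h₄, mul_smul])⟩
    · exact ⟨x * y, Or.inr (by simp [h₁, h₂, h₃, h₄, mul_smul])⟩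
    · exact ⟨x * y, Or.inr (by simp [h₁, h₂, h₃, h₄, mul_smul])⟩
    · exact ⟨x * y, Or.inl (by simp [h₁, h₂, h₃, h₄, mul_smul])⟩

instance ProperFreeSplitting.setoid (G : Type*) [Group G] : Setoid (ProperFreeSplitting G) where
  r := ProperFreeSplitting.Equivalent
  iseqv := ProperFreeSplitting.equivalent_equivalence G

/-- The equivalence classes `[A * B]` of proper free splittings of `G`. -/
def SplittingClass (G : Type*) [Group G] : Type _ :=
  Quotient (ProperFreeSplitting.setoid G)

theorem IsElliptic.of_equivalent {G : Type*} [Group G] {g : G} {S T : ProperFreeSplitting G}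
    (h : S.Equivalent T) (hg : IsElliptic g S.left S.right) : IsElliptic g T.left T.right := by
  obtain ⟨x, ⟨h₁, h₂⟩ | ⟨h₁, h₂⟩⟩ := h <;> obtain ⟨y, hy⟩ := hg <;>
    rw [h₁, h₂, ← mul_smul, ← mul_smul, ← map_mul] at hy
  · exact ⟨y * x, hy⟩
  · exact ⟨y * x, hy.symm⟩

/-- The element `g` is elliptic to the class `[A * B]`: it is elliptic to `A * B`, which does not
depend on the representative. -/
def SplittingClass.IsElliptic {G : Type*} [Group G] (g : G) (c : SplittingClass G) : Prop :=
  Quotient.lift (fun S : ProperFreeSplitting G => EllipticityGraph.IsElliptic g S.left S.right)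
    (fun _ _ h => propext ⟨EllipticityGraph.IsElliptic.of_equivalent h,
      EllipticityGraph.IsElliptic.of_equivalent
        ((ProperFreeSplitting.equivalent_equivalence G).symm h)⟩) c

/-- An element of the free group `F(X)` is primitive if it is the image of a letter under an
automorphism of `F(X)`. -/
def IsPrimitive {X : Type*} (g : FreeGroup X) : Prop :=
  ∃ (φ : FreeGroup X ≃* FreeGroup X) (x : X), g = φ (FreeGroup.of x)

end EllipticityGraph

/-! Bases of `A` and `B` (Nielsen–Schreier) together form a basis of `F`, so one may take `F` free
on `α ⊕ β` with `A` generated by `α`. Let `F` act on the cosets of `C`, and choose a Schreier tree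
that also spans the `A`-orbit of the base coset using only `α`-edges. The edges with nontrivial
Schreier element give a basis of `C`. An `α`-edge in the `A`-orbit has its Schreier element in `A`;
if all of these were trivial, every element of `A ∩ C` would be trivial too. Hence some basis
element of `C` lies in `A` (`exists_basis_mem_range_map_inl`). Adjoining a basis of `D` turns this
basis into one of `F`, so that element is primitive.

Part (2) reduces to (1): conjugating and swapping the factors puts `f` in both left factors. -/

namespace EllipticityGraph

/-! ### Free splittings: normal forms, and bases from bases of the factors -/

section Splitting

variable {G H : Type*} [Group G] [Group H]

/-- An alternating product of nontrivial elements of the two factors is nontrivial. -/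
theorem IsFreeSplitting.prod_ne_one {A B : Subgroup G} (h : IsFreeSplitting A B)
    {L : List (G × G)} (hL : L ≠ [])
    (hmem : ∀ p ∈ L, p.1 ∈ A ∧ p.2 ∈ B ∧ p.1 ≠ 1 ∧ p.2 ≠ 1) :
    (L.map fun p => p.1 * p.2).prod ≠ 1 := by
  intro h1
  obtain ⟨n, hn⟩ : ∃ n, L.length = n + 1 :=
    Nat.exists_eq_succ_of_ne_zero (by simpa using hL)
  have hL' : List.ofFn (fun i : Fin (n + 1) => L.get (i.cast hn.symm)) = L := by
    rw [← List.ofFn_congr hn, List.ofFn_get]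
  obtain ⟨i, hi⟩ := h.eq_one_of_prod_eq_one n (fun i => (L.get (i.cast hn.symm)).1)
    (fun i => (L.get (i.cast hn.symm)).2)
    (fun i => (hmem _ (List.get_mem _ _)).1) (fun i => (hmem _ (List.get_mem _ _)).2.1) (by
      rw [← h1]
      conv_rhs => rw [← hL', List.map_ofFn]
      rfl)
  have := (hmem _ (List.get_mem L (i.cast hn.symm))).2.2
  rcases hi with hi | hi
  · exact this.1 hi
  · exact this.2 hi

/-- Every element of a group generated by `A` and `B` can be written as
`b * (a₁ * b₁) * ⋯ * (aₙ * bₙ) * a` with all `aᵢ` and `bᵢ` nontrivial. -/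
theorem exists_alternating_form {A B : Subgroup H} (h : A ⊔ B = ⊤) (x : H) :
    ∃ b ∈ B, ∃ a ∈ A, ∃ L : List (H × H),
      (∀ p ∈ L, p.1 ∈ A ∧ p.2 ∈ B ∧ p.1 ≠ 1 ∧ p.2 ≠ 1) ∧
      x = b * (L.map fun p => p.1 * p.2).prod * a := by
  have hx : x ∈ Subgroup.closure ((A : Set H) ∪ B) := by
    rw [← Subgroup.sup_eq_closure, h]; trivial
  have hA : ∀ c ∈ A, ∀ y : H, (∃ b ∈ B, ∃ a ∈ A, ∃ L : List (H × H),
      (∀ p ∈ L, p.1 ∈ A ∧ p.2 ∈ B ∧ p.1 ≠ 1 ∧ p.2 ≠ 1) ∧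
      y = b * (L.map fun p => p.1 * p.2).prod * a) →
      ∃ b ∈ B, ∃ a ∈ A, ∃ L : List (H × H),
      (∀ p ∈ L, p.1 ∈ A ∧ p.2 ∈ B ∧ p.1 ≠ 1 ∧ p.2 ≠ 1) ∧
      c * y = b * (L.map fun p => p.1 * p.2).prod * a := by
    rintro c hc _ ⟨b, hb, a, ha, L, hL, rfl⟩
    by_cases hc1 : c = 1
    · exact ⟨b, hb, a, ha, L, hL, by simp [hc1]⟩
    by_cases hb1 : b = 1
    · subst hb1
      cases L with
      | nil => exact ⟨1, one_mem _, c * a, mul_mem hc ha, [], by simp, by simp⟩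
      | cons p L =>
        obtain ⟨hp, hL⟩ := List.forall_mem_cons.1 hL
        -- If the two `A`-letters cancel, `p.2` becomes the new leading `B`-letter.
        by_cases hp1 : c * p.1 = 1
        · exact ⟨p.2, hp.2.1, a, ha, L, hL, by
            simp only [List.map_cons, List.prod_cons, one_mul, ← mul_assoc, hp1]⟩
        · exact ⟨1, one_mem _, a, ha, (c * p.1, p.2) :: L,
            List.forall_mem_cons.2 ⟨⟨mul_mem hc hp.1, hp.2.1, hp1, hp.2.2.2⟩, hL⟩, by
            simp [mul_assoc]⟩
    · exact ⟨1, one_mem _, a, ha, (c, b) :: L, List.forall_mem_cons.2 ⟨⟨hc, hb, hc1, hb1⟩, hL⟩,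
        by simp [mul_assoc]⟩
  have hB : ∀ c ∈ B, ∀ y : H, (∃ b ∈ B, ∃ a ∈ A, ∃ L : List (H × H),
      (∀ p ∈ L, p.1 ∈ A ∧ p.2 ∈ B ∧ p.1 ≠ 1 ∧ p.2 ≠ 1) ∧
      y = b * (L.map fun p => p.1 * p.2).prod * a) →
      ∃ b ∈ B, ∃ a ∈ A, ∃ L : List (H × H),
      (∀ p ∈ L, p.1 ∈ A ∧ p.2 ∈ B ∧ p.1 ≠ 1 ∧ p.2 ≠ 1) ∧
      c * y = b * (L.map fun p => p.1 * p.2).prod * a := by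
    rintro c hc _ ⟨b, hb, a, ha, L, hL, rfl⟩
    exact ⟨c * b, mul_mem hc hb, a, ha, L, hL, by simp [mul_assoc]⟩
  induction hx using Subgroup.closure_induction_left with
  | one => exact ⟨1, one_mem _, 1, one_mem _, [], by simp, by simp⟩
  | mul_left c hc y _ ih => exact hc.elim (fun hc => hA c hc y ih) (fun hc => hB c hc y ih)
  | inv_mul_cancel c hc y _ ih =>
    exact hc.elim (fun hc => hA _ (inv_mem hc) y ih) (fun hc => hB _ (inv_mem hc) y ih)

/-- A homomorphism onto a free splitting that is injective on subgroups lying over the two factors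
is injective, provided these subgroups generate. -/
theorem injective_of_isFreeSplitting {A B : Subgroup G} (h : IsFreeSplitting A B) (π : H →* G)
    {A' B' : Subgroup H} (hsup : A' ⊔ B' = ⊤) (hA : ∀ a ∈ A', π a ∈ A) (hB : ∀ b ∈ B', π b ∈ B)
    (hA1 : ∀ a ∈ A', π a = 1 → a = 1) (hB1 : ∀ b ∈ B', π b = 1 → b = 1) :
    Function.Injective π := by
  rw [injective_iff_map_eq_one]
  intro x hx
  obtain ⟨b, hb, a, ha, L, hL, rfl⟩ := exists_alternating_form hsup x
  have key : ∀ M : List (H × H), M ≠ [] →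
      (∀ p ∈ M, p.1 ∈ A' ∧ p.2 ∈ B' ∧ p.1 ≠ 1 ∧ p.2 ≠ 1) →
      π (M.map fun p => p.1 * p.2).prod ≠ 1 := by
    intro M hM hmem
    have := h.prod_ne_one (L := M.map fun p => (π p.1, π p.2)) (by simpa using hM) (by
      intro p hp
      obtain ⟨q, hq, rfl⟩ := List.mem_map.1 hp
      obtain ⟨h1, h2, h3, h4⟩ := hmem q hq
      exact ⟨hA _ h1, hB _ h2, fun h => h3 (hA1 _ h1 h), fun h => h4 (hB1 _ h2 h)⟩)
    rw [List.map_map] at this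
    rw [map_list_prod, List.map_map]
    convert! this using 4
    exact funext fun p => map_mul π _ _
  have hcons : ∀ (p q : H) (M : List (H × H)), p ∈ A' → q ∈ B' → p ≠ 1 → q ≠ 1 →
      (∀ p ∈ M, p.1 ∈ A' ∧ p.2 ∈ B' ∧ p.1 ≠ 1 ∧ p.2 ≠ 1) →
      ∀ r ∈ (p, q) :: M, r.1 ∈ A' ∧ r.2 ∈ B' ∧ r.1 ≠ 1 ∧ r.2 ≠ 1 :=
    fun p q M h1 h2 h3 h4 h5 => List.forall_mem_cons.2 ⟨⟨h1, h2, h3, h4⟩, h5⟩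
  have happ : ∀ M N : List (H × H), (∀ p ∈ M, p.1 ∈ A' ∧ p.2 ∈ B' ∧ p.1 ≠ 1 ∧ p.2 ≠ 1) →
      (∀ p ∈ N, p.1 ∈ A' ∧ p.2 ∈ B' ∧ p.1 ≠ 1 ∧ p.2 ≠ 1) →
      ∀ p ∈ M ++ N, p.1 ∈ A' ∧ p.2 ∈ B' ∧ p.1 ≠ 1 ∧ p.2 ≠ 1 :=
    fun M N hM hN => List.forall_mem_append.2 ⟨hM, hN⟩
  by_cases ha1 : a = 1 <;> by_cases hb1 : b = 1
  · subst ha1 hb1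
    rcases eq_or_ne L [] with rfl | hne
    · simp
    · exact absurd (by simpa using hx) (key L hne hL)
  · subst ha1
    cases L with
    | nil => exact absurd (hB1 b hb (by simpa using hx)) hb1
    | cons p L =>
      have hp := (List.forall_mem_cons.1 hL).1
      -- Here `x` begins and ends in `B'`, so with `u = p.1` the product `u⁻¹ x u x` is alternating
      -- from `A'` to `B'`, yet `π` kills it.
      refine absurd ?_ (key ((p.1⁻¹, b) :: ((p :: L) ++ (p.1, b) :: (p :: L))) (by simp)
        (hcons _ _ _ (inv_mem hp.1) hb (by simpa using hp.2.2.1) hb1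
          (happ _ _ hL (hcons _ _ _ hp.1 hb hp.2.2.1 hb1 hL))))
      have e : (((p.1⁻¹, b) :: ((p :: L) ++ (p.1, b) :: (p :: L))).map fun p => p.1 * p.2).prod
          = p.1⁻¹ * (b * ((p :: L).map fun p => p.1 * p.2).prod * 1) * p.1 *
            (b * ((p :: L).map fun p => p.1 * p.2).prod * 1) := by
        simp [mul_assoc]
      rw [e, map_mul, map_mul, map_mul, hx]
      simp
  · subst hb1
    cases L with
    | nil => exact absurd (hA1 a ha (by simpa using hx)) ha1
    | cons p L =>
      have hp := (List.forall_mem_cons.1 hL).1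
      -- Here `x` begins and ends in `A'`; with `v = p.2` the alternating product is `x v x v⁻¹`.
      refine absurd ?_ (key ((p :: L) ++ (a, p.2) :: ((p :: L) ++ [(a, p.2⁻¹)])) (by simp)
        (happ _ _ hL (hcons _ _ _ ha hp.2.1 ha1 hp.2.2.2 (happ _ _ hL
          (hcons _ _ _ ha (inv_mem hp.2.1) ha1 (by simpa using hp.2.2.2) (by simp))))))
      have e : (((p :: L) ++ (a, p.2) :: ((p :: L) ++ [(a, p.2⁻¹)])).map fun p => p.1 * p.2).prod
          = (1 * ((p :: L).map fun p => p.1 * p.2).prod * a) * p.2 *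
            (1 * ((p :: L).map fun p => p.1 * p.2).prod * a) * p.2⁻¹ := by
        simp [mul_assoc]
      rw [e, map_mul, map_mul, map_mul, hx]
      simp
  -- Conjugating `x` by `b` moves the leading `B'`-letter to the end.
  · refine absurd ?_ (key (L ++ [(a, b)]) (by simp)
      (happ _ _ hL (hcons _ _ _ ha hb ha1 hb1 (by simp))))
    have e : ((L ++ [(a, b)]).map fun p => p.1 * p.2).prod
        = b⁻¹ * (b * (L.map fun p => p.1 * p.2).prod * a) * b := by
      simp [mul_assoc]
    rw [e, map_mul, map_mul, hx]
    simp

/-- Bases of the factors of a free splitting form a basis of the group. -/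
theorem IsFreeSplitting.exists_basis {A B : Subgroup G} (h : IsFreeSplitting A B) {α β : Type*}
    (bA : FreeGroupBasis α A) (bB : FreeGroupBasis β B) :
    ∃ b : FreeGroupBasis (α ⊕ β) G, (∀ i, b (Sum.inl i) = bA i) ∧ ∀ i, b (Sum.inr i) = bB i := by
  let π : FreeGroup (α ⊕ β) →* G :=
    FreeGroup.lift (Sum.elim (fun i => (bA i : G)) (fun i => (bB i : G)))
  have hπA : ∀ x, π (FreeGroup.map Sum.inl x) = (bA.repr.symm x : G) := by
    intro x
    have : π.comp (FreeGroup.map Sum.inl) = A.subtype.comp bA.repr.symm.toMonoidHom := by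
      ext i; simp [π]; rfl
    exact DFunLike.congr_fun this x
  have hπB : ∀ x, π (FreeGroup.map Sum.inr x) = (bB.repr.symm x : G) := by
    intro x
    have : π.comp (FreeGroup.map Sum.inr) = B.subtype.comp bB.repr.symm.toMonoidHom := by
      ext i; simp [π]; rfl
    exact DFunLike.congr_fun this x
  have hinj : Function.Injective π := by
    refine injective_of_isFreeSplitting h π (A' := (FreeGroup.map Sum.inl).range)
      (B' := (FreeGroup.map Sum.inr).range) ?_ ?_ ?_ ?_ ?_
    · rw [eq_top_iff, ← FreeGroup.closure_range_of, Subgroup.closure_le]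
      rintro _ ⟨i | i, rfl⟩
      · exact Subgroup.mem_sup_left ⟨FreeGroup.of i, by simp⟩
      · exact Subgroup.mem_sup_right ⟨FreeGroup.of i, by simp⟩
    · rintro _ ⟨x, rfl⟩
      rw [hπA]; exact SetLike.coe_mem _
    · rintro _ ⟨x, rfl⟩
      rw [hπB]; exact SetLike.coe_mem _
    · rintro _ ⟨x, rfl⟩ hx
      rw [hπA] at hx
      have : x = 1 := by simpa using hx
      simp [this]
    · rintro _ ⟨x, rfl⟩ hx
      rw [hπB] at hx
      have : x = 1 := by simpa using hx
      simp [this]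
  have hsurj : Function.Surjective π := by
    rw [← MonoidHom.range_eq_top, eq_top_iff, ← h.sup_eq_top, sup_le_iff]
    refine ⟨fun x hx => ⟨FreeGroup.map Sum.inl (bA.repr ⟨x, hx⟩), ?_⟩,
      fun x hx => ⟨FreeGroup.map Sum.inr (bB.repr ⟨x, hx⟩), ?_⟩⟩
    · rw [hπA]; simp
    · rw [hπB]; simp
  refine ⟨.ofRepr (MulEquiv.ofBijective π ⟨hinj, hsurj⟩).symm, fun i => ?_, fun i => ?_⟩
  · change π (FreeGroup.of (Sum.inl i)) = _
    simp [π]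
  · change π (FreeGroup.of (Sum.inr i)) = _
    simp [π]

/-- Inverting `b₀a₀⋯bₙaₙ` gives `aₙ⁻¹bₙ⁻¹⋯a₀⁻¹b₀⁻¹`, whence the reversed indices. -/
theorem IsFreeSplitting.symm {A B : Subgroup G} (h : IsFreeSplitting A B) :
    IsFreeSplitting B A where
  sup_eq_top := by rw [sup_comm, h.sup_eq_top]
  eq_one_of_prod_eq_one := by
    intro n b a hb ha h1
    obtain ⟨i, hi⟩ := h.eq_one_of_prod_eq_one n (fun i => (a i.rev)⁻¹) (fun i => (b i.rev)⁻¹)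
      (fun i => inv_mem (ha _)) (fun i => inv_mem (hb _)) (by
        have := congrArg (·⁻¹) h1
        simp only [List.prod_inv_reverse, inv_one, List.map_ofFn] at this
        rw [← this]
        congr 1
        refine List.ext_getElem (by simp) fun i hi hi' => ?_
        have hin : i < n + 1 := by simpa using hi'
        simp only [List.getElem_reverse, List.getElem_ofFn, Function.comp_apply, mul_inv_rev,
          List.length_ofFn, Fin.rev]
        refine congrArg₂ (fun u v => (a u)⁻¹ * (b v)⁻¹) ?_ ?_ <;> ext <;> simp only <;> omega)
    exact ⟨i.rev, by simpa [or_comm] using hi⟩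

theorem IsFreeSplitting.conj {A B : Subgroup G} (h : IsFreeSplitting A B) (x : G) :
    IsFreeSplitting (MulAut.conj x • A) (MulAut.conj x • B) where
  sup_eq_top := by
    rw [← Subgroup.smul_sup, h.sup_eq_top]
    simp
  eq_one_of_prod_eq_one := by
    intro n a b ha hb h1
    obtain ⟨i, hi⟩ := h.eq_one_of_prod_eq_one n (fun i => (MulAut.conj x)⁻¹ (a i))
      (fun i => (MulAut.conj x)⁻¹ (b i))
      (fun i => Subgroup.mem_pointwise_smul_iff_inv_smul_mem.1 (ha i))
      (fun i => Subgroup.mem_pointwise_smul_iff_inv_smul_mem.1 (hb i)) (by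
        have := congrArg ((MulAut.conj x)⁻¹ : MulAut G) h1
        rw [map_list_prod, List.map_ofFn, map_one] at this
        rw [← this]
        congr 2
        ext i
        simp [mul_assoc])
    exact ⟨i, by simpa only [EmbeddingLike.map_eq_one_iff] using hi⟩

end Splitting
end EllipticityGraph
namespace EllipticityGraph

/-! ### Schreier transversals and a basis of `C` adapted to a free factor -/

section Schreier

open FreeGroup (of)

universe u v

variable {α : Type u} {β : Type v} {C : Subgroup (FreeGroup (α ⊕ β))}

theorem exists_word_of_mem_range_map_inl {g : FreeGroup (α ⊕ β)}
    (hg : g ∈ (FreeGroup.map (Sum.inl : α → α ⊕ β)).range) :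
    ∃ l : List ((α ⊕ β) × Bool), FreeGroup.mk l = g ∧ l.countP (fun p => p.1.isRight) = 0 := by
  classical
  obtain ⟨x, rfl⟩ := hg
  refine ⟨x.toWord.map fun p => (Sum.inl p.1, p.2), ?_, ?_⟩
  · conv_rhs => rw [← FreeGroup.mk_toWord (x := x), FreeGroup.map.mk]
  · simp [List.countP_map, List.countP_eq_zero]

theorem mk_mem_range_map_inl {l : List ((α ⊕ β) × Bool)}
    (hl : l.countP (fun p => p.1.isRight) = 0) :
    FreeGroup.mk l ∈ (FreeGroup.map (Sum.inl : α → α ⊕ β)).range := by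
  induction l with
  | nil => exact one_mem _
  | cons p l ih =>
    obtain ⟨i | i, ε⟩ := p
    · have e : FreeGroup.mk ((Sum.inl i, ε) :: l) = FreeGroup.mk [(Sum.inl i, ε)] *
          FreeGroup.mk (α := α ⊕ β) l := by simp [FreeGroup.mul_mk]
      rw [e]
      exact mul_mem ⟨FreeGroup.mk [(i, ε)], by simp⟩ (ih (by simpa using hl))
    · simp at hl

/-- In a transitive action of the free group on `α ⊕ β`, every point other than the base point has
a neighbour closer to it, along an edge labelled in `α` if the point can be reached by such
edges. -/
theorem exists_parent {Q : Type*} [MulAction (FreeGroup (α ⊕ β)) Q] (o : Q)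
    (ho : ∀ q : Q, ∃ g : FreeGroup (α ⊕ β), g • o = q) :
    ∃ c : Q → ℕ ×ₗ ℕ, ∀ q ≠ o, ∃ (s : (α ⊕ β) × Bool) (q' : Q), c q' < c q ∧
      q = FreeGroup.mk [s] • q' ∧
      ((∃ g ∈ (FreeGroup.map (Sum.inl : α → α ⊕ β)).range, g • o = q) → s.1.isLeft ∧
        ∃ g ∈ (FreeGroup.map (Sum.inl : α → α ⊕ β)).range, g • o = q') := by
  classical
  -- Counting `β`-letters before length forces a cheapest word to avoid `β` wherever that is
  -- possible.
  let cost : List ((α ⊕ β) × Bool) → ℕ ×ₗ ℕ :=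
    fun l => toLex (l.countP (fun p => p.1.isRight), l.length)
  have hmin : ∀ q : Q, ∃ l : List ((α ⊕ β) × Bool), FreeGroup.mk l • o = q ∧
      ∀ l', FreeGroup.mk l' • o = q → cost l ≤ cost l' := by
    intro q
    obtain ⟨g, hg⟩ := ho q
    have hne : {l : List ((α ⊕ β) × Bool) | FreeGroup.mk l • o = q}.Nonempty :=
      ⟨g.toWord, by rw [Set.mem_ofPred_eq, FreeGroup.mk_toWord, hg]⟩
    exact ⟨Function.argminOn cost _ hne, Function.argminOn_mem cost _ hne,
      fun l' hl' => Function.argminOn_le cost _ hl'⟩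
  choose w hw hwmin using hmin
  refine ⟨fun q => cost (w q), fun q hq => ?_⟩
  have hwq := hw q
  have hwm := hwmin q
  match hl : w q with
  | [] =>
    rw [hl] at hwq
    rw [← FreeGroup.one_eq_mk, one_smul] at hwq
    exact absurd hwq.symm hq
  | s :: l =>
    rw [hl] at hwq hwm
    refine ⟨s, FreeGroup.mk l • o, ?_, ?_, ?_⟩
    · refine lt_of_le_of_lt (hwmin _ l rfl) ?_
      rw [Prod.Lex.lt_iff]
      by_cases hs : s.1.isRight <;> simp [cost, hl, hs]
    · rw [← hwq, smul_smul, FreeGroup.mul_mk]; rfl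
    · rintro ⟨g, hg, hgq⟩
      obtain ⟨l', rfl, hl'⟩ := exists_word_of_mem_range_map_inl hg
      have h0 : (s :: l).countP (fun p => p.1.isRight) = 0 := by
        have := hwm l' hgq
        rw [Prod.Lex.le_iff] at this
        simp only [cost, ofLex_toLex, hl'] at this
        omega
      rw [List.countP_cons] at h0
      refine ⟨?_, FreeGroup.mk l, mk_mem_range_map_inl (by omega), rfl⟩
      by_contra hs
      simp at hs
      simp [hs] at h0

/-- A Schreier transversal for a transitive action of the free group on `α ⊕ β`, which extends one
for the action of the free group on `α` on the orbit of the base point. -/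
theorem exists_transversal {Q : Type*} [MulAction (FreeGroup (α ⊕ β)) Q] (o : Q)
    (ho : ∀ q : Q, ∃ g : FreeGroup (α ⊕ β), g • o = q) :
    ∃ t : Q → FreeGroup (α ⊕ β), t o = 1 ∧ (∀ q, t q • o = q) ∧
      (∀ g ∈ (FreeGroup.map (Sum.inl : α → α ⊕ β)).range,
        t (g • o) ∈ (FreeGroup.map (Sum.inl : α → α ⊕ β)).range) ∧
      ∀ P : Q → Prop, P o →
        (∀ s q, t (FreeGroup.of s • q) = FreeGroup.of s * t q → (P q ↔ P (FreeGroup.of s • q))) →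
        ∀ q, P q := by
  classical
  obtain ⟨c, hc⟩ := exists_parent o ho
  choose s p hlt hp hA using hc
  -- The representative of `q` is read along the path of parents from `q` down to `o`.
  let t : Q → FreeGroup (α ⊕ β) := (InvImage.wf c wellFounded_lt).fix fun q ih =>
    if h : q = o then 1 else FreeGroup.mk [s q h] * ih (p q h) (hlt q h)
  have ht : ∀ q, t q = if h : q = o then 1 else FreeGroup.mk [s q h] * t (p q h) := by
    intro q
    change WellFounded.fix _ _ q = _
    rw [WellFounded.fix_eq]
  have hto : t o = 1 := by rw [ht]; simp
  refine ⟨t, hto, ?_, ?_, ?_⟩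
  · intro q
    induction q using (InvImage.wf c wellFounded_lt).induction with
    | _ q ih =>
      rw [ht]
      split_ifs with h
      · rw [h, one_smul]
      · rw [mul_smul, ih _ (hlt q h), ← hp q h]
  · suffices ∀ q, (∃ g ∈ (FreeGroup.map (Sum.inl : α → α ⊕ β)).range, g • o = q) →
        t q ∈ (FreeGroup.map (Sum.inl : α → α ⊕ β)).range from
      fun g hg => this _ ⟨g, hg, rfl⟩
    intro q
    induction q using (InvImage.wf c wellFounded_lt).induction with
    | _ q ih =>
      intro hq
      rw [ht]
      split_ifs with h
      · exact one_mem _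
      · obtain ⟨h1, h2⟩ := hA q h hq
        refine mul_mem (mk_mem_range_map_inl ?_) (ih _ (hlt q h) h2)
        simp [h1]
  -- Connectedness of the tree. An edge to the parent may carry an inverse letter, so `P` must pass
  -- along edges in both directions.
  · intro P hPo hP q
    induction q using (InvImage.wf c wellFounded_lt).induction with
    | _ q ih =>
      by_cases h : q = o
      · rwa [h]
      have h1 := ih _ (hlt q h)
      have h2 := ht q
      have h3 := hp q h
      rw [dif_neg h] at h2
      generalize s q h = r at h2 h3
      generalize p q h = q' at h1 h2 h3
      obtain ⟨s', ε⟩ := r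
      cases ε
      · have e : FreeGroup.mk [(s', false)] = (FreeGroup.of s')⁻¹ := by
          simp [FreeGroup.of, FreeGroup.inv_mk, FreeGroup.invRev]
        rw [e] at h2 h3
        have h4 : FreeGroup.of s' • q = q' := by rw [h3, smul_inv_smul]
        refine (hP s' q ?_).2 (h4 ▸ h1)
        rw [h4, h2]; simp
      · change q = FreeGroup.of s' • q' at h3
        change t q = FreeGroup.of s' * t q' at h2
        have h4 := (hP s' q' (by rw [← h3, h2])).1 h1
        rwa [← h3] at h4

/-- If a subgroup `C` of the free group on `α ⊕ β` meets the free factor generated by `α`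
nontrivially, then `C` has a basis with an element in this free factor. -/
theorem exists_basis_mem_range_map_inl
    (hC : (FreeGroup.map (Sum.inl : α → α ⊕ β)).range ⊓ C ≠ ⊥) :
    ∃ (ι : Type (max u v)) (b : FreeGroupBasis ι C) (i : ι),
      (b i : FreeGroup (α ⊕ β)) ∈ (FreeGroup.map (Sum.inl : α → α ⊕ β)).range := by
  classical
  let Q := FreeGroup (α ⊕ β) ⧸ C
  let o : Q := ((1 : FreeGroup (α ⊕ β)) : Q)
  have ho : ∀ q : Q, ∃ g : FreeGroup (α ⊕ β), g • o = q := fun q => MulAction.exists_smul_eq (FreeGroup (α ⊕ β)) o q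
  have hstab : ∀ g : FreeGroup (α ⊕ β), g • o = o ↔ g ∈ C := by
    intro g
    change ((g * 1 : FreeGroup (α ⊕ β)) : Q) = ((1 : FreeGroup (α ⊕ β)) : Q) ↔ _
    rw [QuotientGroup.eq, mul_one, mul_one, inv_mem_iff]
  obtain ⟨t, hto, hts, htA, hconn⟩ := exists_transversal o ho
  have hloop : ∀ (g : FreeGroup (α ⊕ β)) (q : Q), (t q)⁻¹ * g * t (g⁻¹ • q) ∈ C := by
    intro g q
    rw [← hstab, mul_smul, hts, mul_smul, smul_inv_smul, inv_smul_eq_iff, hts]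
  -- The Schreier elements, which form a cocycle in `g`.
  let loop : FreeGroup (α ⊕ β) → Q → C := fun g q => ⟨(t q)⁻¹ * g * t (g⁻¹ • q), hloop g q⟩
  have loop_mul : ∀ g h q, loop (g * h) q = loop g q * loop h (g⁻¹ • q) := by
    intro g h q
    ext
    simp [loop, mul_assoc, mul_smul]
  let E := {e : (α ⊕ β) × Q // loop (of e.1) e.2 ≠ 1}
  let lab : (α ⊕ β) → Q → FreeGroup E := fun s q =>
    if h : loop (of s) q ≠ 1 then of ⟨(s, q), h⟩ else 1
  -- A cocycle is a homomorphism to the semidirect product that splits the projection. Freeness thus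
  -- gives a universal cocycle `D` with values in `FreeGroup E` from its values on the letters.
  let Ψ : FreeGroup (α ⊕ β) →* (Q → FreeGroup E) ⋊[mulAutArrow] FreeGroup (α ⊕ β) :=
    FreeGroup.lift fun s => ⟨lab s, of s⟩
  have Ψr : ∀ g, (Ψ g).right = g := by
    intro g
    have : SemidirectProduct.rightHom.comp Ψ = MonoidHom.id _ := by
      ext s; simp [Ψ]
    exact DFunLike.congr_fun this g
  let D : FreeGroup (α ⊕ β) → Q → FreeGroup E := fun g => (Ψ g).left
  have D_mul : ∀ g h q, D (g * h) q = D g q * D h (g⁻¹ • q) := by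
    intro g h q
    simp only [D, map_mul, SemidirectProduct.mul_left, Ψr]
    rfl
  have D_of : ∀ s q, D (of s) q = lab s q := by
    intro s q; simp only [D, Ψ, FreeGroup.lift_apply_of]
  have D_one : ∀ q, D 1 q = 1 := by intro q; simp [D]
  have loop_one : ∀ q, loop 1 q = 1 := by intro q; ext; simp [loop]
  let κ : FreeGroup E →* C := FreeGroup.lift fun e => loop (of e.1.1) e.1.2
  have κlab : ∀ s q, κ (lab s q) = loop (of s) q := by
    intro s q
    by_cases h : loop (of s) q = 1
    · simp [lab, h]
    · simp [lab, h, κ]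
  -- Both sides are cocycles that agree on the letters.
  have κD : ∀ g q, κ (D g q) = loop g q := by
    intro g
    induction g using FreeGroup.induction_on with
    | C1 => intro q; rw [D_one, loop_one, map_one]
    | of s => intro q; rw [D_of, κlab]
    | inv_of s ih =>
      intro q
      have h1 := D_mul (of s)⁻¹ (of s) q
      have h2 := loop_mul (of s)⁻¹ (of s) q
      rw [inv_mul_cancel, D_one] at h1
      rw [inv_mul_cancel, loop_one] at h2
      rw [eq_inv_of_mul_eq_one_left h1.symm, eq_inv_of_mul_eq_one_left h2.symm, map_inv, ih]
    | mul g h ihg ihh => intro q; rw [D_mul, loop_mul, map_mul, ihg, ihh]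
  -- As `C` fixes `o`, the cocycle identity at `o` becomes multiplicativity on `C`.
  let θ : C →* FreeGroup E :=
    { toFun := fun c => D c o
      map_one' := D_one o
      map_mul' := fun c d => by
        rw [Subgroup.coe_mul, D_mul, (hstab _).2 (inv_mem c.2)] }
  -- Tree edges have trivial Schreier element and hence label `1`, so `D` is trivial along tree
  -- paths.
  have Dt : ∀ q, D (t q) q = 1 := by
    refine hconn _ (by rw [hto, D_one]) fun s q hq => ?_
    have h1 : loop (of s) (of s • q) = 1 := by
      ext; simp only [loop, inv_smul_smul, hq]; simp
    rw [hq, D_mul, inv_smul_smul, D_of]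
    simp [lab, h1]
  have κθ : ∀ c, κ (θ c) = c := by
    intro c
    change κ (D c o) = c
    rw [κD]
    ext
    simp [loop, hto, (hstab _).2 (inv_mem c.2)]
  have D_inv : ∀ g q, D g⁻¹ q = (D g (g • q))⁻¹ := by
    intro g q
    have h1 := D_mul g⁻¹ g q
    rw [inv_mul_cancel, D_one, inv_inv] at h1
    exact eq_inv_of_mul_eq_one_left h1.symm
  have θκ : θ.comp κ = MonoidHom.id _ := by
    ext ⟨⟨s, q⟩, h⟩
    change θ (κ (of _)) = of _
    have e : κ (of ⟨(s, q), h⟩) = loop (of s) q := by simp [κ]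
    rw [e]
    change D ((t q)⁻¹ * of s * t ((of s)⁻¹ • q)) o = _
    rw [D_mul, D_mul, D_inv, hts, Dt, inv_inv, hts, mul_inv_rev, inv_inv, mul_smul, hts, Dt, D_of]
    simp [lab, h]
  let b : FreeGroupBasis E C := .ofRepr
    { toFun := θ
      invFun := κ
      left_inv := κθ
      right_inv := fun x => DFunLike.congr_fun θκ x
      map_mul' := map_mul θ }
  have hb : ∀ e, b e = loop (of e.1.1) e.1.2 := by
    intro e
    change κ (of e) = _
    simp [κ]
  by_contra! hcon
  apply hC
  rw [eq_bot_iff]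
  rintro c ⟨⟨x, hx⟩, hcC⟩
  -- On the `A`-orbit the representatives lie in `A`, so a nontrivial Schreier element of an
  -- `α`-edge would be a basis element in `A`.
  have hs : ∀ (i : α) (g : FreeGroup (α ⊕ β)), g ∈ (FreeGroup.map (Sum.inl : α → α ⊕ β)).range →
      loop (of (Sum.inl i)) (g • o) = 1 := by
    intro i g hg
    by_contra h
    refine hcon E b ⟨(Sum.inl i, g • o), h⟩ ?_
    rw [hb]
    have hi : of (Sum.inl i) ∈ (FreeGroup.map (Sum.inl : α → α ⊕ β)).range := ⟨of i, by simp⟩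
    refine mul_mem (mul_mem (inv_mem (htA g hg)) hi) ?_
    rw [smul_smul]
    exact htA _ (mul_mem (inv_mem hi) hg)
  have hx1 : ∀ (x : FreeGroup α) (g : FreeGroup (α ⊕ β)), g ∈ (FreeGroup.map (Sum.inl : α → α ⊕ β)).range →
      loop (FreeGroup.map Sum.inl x) (g • o) = 1 := by
    intro x
    induction x using FreeGroup.induction_on with
    | C1 => intro g hg; rw [map_one, loop_one]
    | of i => intro g hg; rw [FreeGroup.map.of]; exact hs i g hg
    | inv_of i ih =>
      intro g hg
      have h2 := loop_mul (FreeGroup.map Sum.inl (of i))⁻¹ (FreeGroup.map Sum.inl (of i)) (g • o)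
      rw [inv_mul_cancel, loop_one, inv_inv, smul_smul, ih _ (mul_mem ⟨_, rfl⟩ hg), mul_one] at h2
      rw [map_inv, ← h2]
    | mul x y ihx ihy =>
      intro g hg
      rw [map_mul, loop_mul, ihx g hg, smul_smul, ihy _ (mul_mem (inv_mem ⟨_, rfl⟩) hg), mul_one]
  -- For `c` in `A ∩ C` the Schreier element at `o` is `c` itself, as `t o = 1` and `c` fixes `o`.
  have h1 := hx1 x 1 (one_mem _)
  rw [hx, one_smul] at h1
  have h2 := κθ ⟨c, hcC⟩
  have h3 := congrArg Subtype.val h1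
  change (t o)⁻¹ * c * t (c⁻¹ • o) = 1 at h3
  rw [(hstab _).2 (inv_mem hcC), hto] at h3
  simpa using h3

end Schreier
end EllipticityGraph
-- Primitive elements and the main theorem
namespace EllipticityGraph

/-- The elements of a basis of a free group are primitive. -/
theorem isPrimitive_of_basis {X ι : Type*} (b : FreeGroupBasis ι (FreeGroup X)) (i : ι) :
    IsPrimitive (b i) := by
  -- Bases of isomorphic free groups are equinumerous; relabelling by `e` makes the isomorphism an
  -- automorphism.
  let e : ι ≃ X := Equiv.ofFreeGroupEquiv b.repr.symm
  exact ⟨(FreeGroup.freeGroupCongr e.symm).trans b.repr.symm, e i, by simp; rfl⟩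

/-- The splitting `A * B` supplies coordinates in which `A` is generated by letters; `C * D` then
extends the adapted basis of `C` to one of the whole group. -/
theorem exists_isPrimitive_mem_inf {X : Type*} {A B C D : Subgroup (FreeGroup X)}
    (hAB : IsFreeSplitting A B) (hCD : IsFreeSplitting C D) (hAC : A ⊓ C ≠ ⊥) :
    ∃ g ∈ A ⊓ C, IsPrimitive g := by
  obtain ⟨b, hbA, -⟩ := hAB.exists_basis (IsFreeGroup.basis A) (IsFreeGroup.basis B)
  let e := b.repr.symm
  have hinl : ∀ x, e (FreeGroup.map Sum.inl x) =
      ((IsFreeGroup.basis A).repr.symm x : FreeGroup X) := by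
    intro x
    have : e.toMonoidHom.comp (FreeGroup.map Sum.inl) =
        A.subtype.comp (IsFreeGroup.basis A).repr.symm.toMonoidHom := by
      ext i
      exact hbA i
    exact DFunLike.congr_fun this x
  have hA : ∀ x, x ∈ A ↔ e.symm x ∈ (FreeGroup.map Sum.inl).range := by
    intro x
    constructor
    · intro hx
      exact ⟨(IsFreeGroup.basis A).repr ⟨x, hx⟩, e.injective (by rw [hinl]; simp)⟩
    · rintro ⟨y, hy⟩
      rw [← e.apply_symm_apply x, ← hy, hinl]
      exact SetLike.coe_mem _
  obtain ⟨ι, b', i, hi⟩ := exists_basis_mem_range_map_inl (C := C.map e.symm.toMonoidHom) (by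
    obtain ⟨⟨x, hx⟩, hx1⟩ := Subgroup.ne_bot_iff_exists_ne_one.1 hAC
    refine Subgroup.ne_bot_iff_exists_ne_one.2
      ⟨⟨e.symm x, (hA x).1 hx.1, Subgroup.mem_map_of_mem _ hx.2⟩, ?_⟩
    intro h
    have h' : e.symm x = 1 := congrArg Subtype.val h
    exact hx1 (Subtype.ext (by simpa using h')))
  let bC : FreeGroupBasis ι C := b'.map (e.symm.subgroupMap C).symm
  obtain ⟨bF, hbF, -⟩ := hCD.exists_basis bC (IsFreeGroup.basis D)
  have hbi : e.symm (bF (Sum.inl i)) = b' i := by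
    rw [hbF]
    exact congrArg Subtype.val ((e.symm.subgroupMap C).apply_symm_apply (b' i))
  refine ⟨bF (Sum.inl i), Subgroup.mem_inf.2 ⟨?_, ?_⟩, isPrimitive_of_basis bF _⟩
  · rw [hA, hbi]; exact hi
  · rw [hbF]; exact SetLike.coe_mem _

/-- An elliptic element lies in the left factor of some free splitting whose left factor consists
of elliptic elements. -/
theorem IsElliptic.exists_isFreeSplitting {G : Type*} [Group G] {g : G} {A B : Subgroup G}
    (h : IsFreeSplitting A B) (hg : IsElliptic g A B) :
    ∃ A' B' : Subgroup G, IsFreeSplitting A' B' ∧ g ∈ A' ∧ ∀ x ∈ A', IsElliptic x A B := by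
  obtain ⟨x, hx | hx⟩ := hg
  · exact ⟨_, _, h.conj x, hx, fun y hy => ⟨x, Or.inl hy⟩⟩
  · exact ⟨_, _, (h.conj x).symm, hx, fun y hy => ⟨x, Or.inr hy⟩⟩

end EllipticityGraph

theorem mainTheorem5 {X : Type*} :
    (∀ A B C D : Subgroup (FreeGroup X),
      EllipticityGraph.IsFreeSplitting A B → EllipticityGraph.IsFreeSplitting C D →
      A ⊓ C ≠ ⊥ →
      ∃ g ∈ A ⊓ C, EllipticityGraph.IsPrimitive g) ∧
    (∀ S T : EllipticityGraph.SplittingClass (FreeGroup X),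
      (∃ f : FreeGroup X, f ≠ 1 ∧ S.IsElliptic f ∧ T.IsElliptic f) →
      ∃ g : FreeGroup X, EllipticityGraph.IsPrimitive g ∧ S.IsElliptic g ∧ T.IsElliptic g) := by
  refine ⟨fun A B C D => EllipticityGraph.exists_isPrimitive_mem_inf, fun S T => ?_⟩
  induction S using Quotient.inductionOn with | _ S => ?_
  induction T using Quotient.inductionOn with | _ T => ?_
  rintro ⟨f, hf, hS, hT⟩
  obtain ⟨A, B, hAB, hfA, hA⟩ :=
    EllipticityGraph.IsElliptic.exists_isFreeSplitting S.isFreeSplitting hS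
  obtain ⟨C, D, hCD, hfC, hC⟩ :=
    EllipticityGraph.IsElliptic.exists_isFreeSplitting T.isFreeSplitting hT
  obtain ⟨g, hg, hprim⟩ := EllipticityGraph.exists_isPrimitive_mem_inf hAB hCD
    fun h => hf (Subgroup.mem_bot.1 (h ▸ ⟨hfA, hfC⟩))
  exact ⟨g, hprim, hA g hg.1, hC g hg.2⟩
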